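/- Let $P$ be a Markov kernel on a measurable space $(\mathcal X,\mathcal B)$ with stationary probability distribution $\pi$, let $R_0\in\mathcal B$ (the "large set"), and let $f:\mathcal X\to[0,\infty)$ be measurable. Let $0\le\lambda<1$ and $b\in\mathbb R$ be such that $$\int f(y)\,P(x,dy)\le\lambda f(x)+b\qquad\text{for all }x\in R_0,$$ and suppose that at least one of the following holds. (C1) $R_0=\{x\in\mathcal X: f(x)\le d_0\}$ for some $d_0>0$. (C1') For some $I\ge1$, $P=P_1P_2\cdots P_I$, that is, $P(x,dy)=\int P_1(x,dx_1)P_2(x_1,dx_2)\cdots P_I(x_{I-1},dy)$, where each $P_i$ is a Markov kernel reversible with respect to $\pi$; and $$\int f(y)\,\tilde P(x,dy)\le\int f(y)\,P(x,dy)\qquad\text{for all }x\in R_0,$$ where $\tilde P=\tilde P_1\cdots\tilde P_I$ and $\tilde P_i$ is the kernel on $R_0$ obtained from $P_i$ by replacing every move out of $R_0$ by staying put: $\tilde P_i(x,B)=P_i(x,B\cap R_0)+P_i(x,R_0^c)\,\mathbf 1_B(x)$ for $x\in R_0$ (so that $\tilde P_i(x,\cdot)=P_i(x,\cdot)$ on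 $R_0\setminus\{x\}$ and $\tilde P_i(x,\{x\})=1-P_i(x,R_0\setminus\{x\})$). Let $d>2b/(1-\lambda)$, and suppose that for some $\varepsilon>0$ and some probability measure $Q$ on $\mathcal X$, $$P(x,\cdot)\ge\varepsilon\,Q(\cdot)\qquad\text{for all }x\text{ with }f(x)\le d.$$ Let $X^{(0)},X^{(1)},\dots$ be a Markov chain with kernel $P$ and initial distribution $\nu$, where $\nu(R_0)=1$ and $E_\nu f=\int f\,d\nu<\infty$. Put $$\alpha^{-1}=\frac{1+2b+\lambda d}{1+d},\qquad \Lambda=1+2(\lambda d+b),\qquad P^i(\nu,A)=\int P^i(x,A)\,\nu(dx).$$ Then for every $0<r<1$ and every integer $k\ge1$, $$\sup_{B\in\mathcal B}\bigl|\Pr(X^{(k)}\in B)-\pi(B)\bigr|\le(1-\varepsilon Q(R_0))^{rk}+\frac{(\alpha\Lambda)^{rk}\left[1+E_\nu f+\frac{b}{1-\lambda}\right]-\alpha^{rk}}{\alpha^k-\alpha^{rk}}+k\,\pi(R_0^c)+\sum_{i=1}^kP^i(\nu,R_0^c).$$ -/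

import Mathlib

open MeasureTheory ProbabilityTheory
open scoped ENNReal

noncomputable section

/-- Total variation distance `sup_B |μ(B) - ν(B)|` over measurable sets `B`, for probability
measures. -/
def tvDist {X : Type*} [MeasurableSpace X] (μ ν : Measure X) : ℝ :=
  ⨆ B : {B : Set X // MeasurableSet B}, |μ.real B.1 - ν.real B.1|

/-- The step `κ` restricted to `R₀`: moves that would leave `R₀` are replaced by staying put.
For `x ∈ R₀` this is the measure that agrees with `κ x` on `R₀ \ {x}` and puts the remaining mass
`1 - κ x (R₀ \ {x})` on `x`. A chain with these steps that starts in `R₀` stays in `R₀`; the values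
at points outside `R₀` play no role. -/
def restrictedStep {X : Type*} [MeasurableSpace X] (κ : Kernel X X) (R₀ : Set X)
    (hR₀ : MeasurableSet R₀) : Kernel X X where
  toFun x := (κ x).restrict R₀ + κ x R₀ᶜ • Measure.dirac x
  measurable' := by
    refine Measure.measurable_of_measurable_coe _ fun B hB => ?_
    simp only [Measure.coe_add, Pi.add_apply, Measure.smul_apply, smul_eq_mul,
      Measure.restrict_apply hB, Measure.dirac_apply' _ hB]
    exact (κ.measurable_coe (hB.inter hR₀)).add
      ((κ.measurable_coe hR₀.compl).mul (measurable_one.indicator hB))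

/-- The kernel of one sweep through the steps `κ 0, κ 1, …, κ (I - 1)`, performed in this order:
`∫ κ 0 (x, dx₁) κ 1 (x₁, dx₂) ⋯ κ (I - 1) (x_{I - 1}, dy)`. -/
def composeSteps {X : Type*} [MeasurableSpace X] :
    (I : ℕ) → (Fin I → Kernel X X) → Kernel X X
  | 0, _ => Kernel.id
  | I + 1, κ => (κ (Fin.last I)) ∘ₖ (composeSteps I fun i => κ i.castSucc)

/-- First alternative: the large set is a sublevel set of the drift function. -/
def LargeSetIsSublevel {X : Type*} (f : X → ℝ) (R₀ : Set X) : Prop :=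
  ∃ d₀ : ℝ, 0 < d₀ ∧ R₀ = {x | f x ≤ d₀}

/-- Second alternative: the kernel is a composition of finitely many Markov steps, each reversible
with respect to `π`, and the chain with restricted steps has, from every point of the large set,
an expected value of the drift function after one sweep that is at most the original one. -/
def ReversibleStepsCondition {X : Type*} [MeasurableSpace X] (P : Kernel X X) (π : Measure X)
    (R₀ : Set X) (hR₀ : MeasurableSet R₀) (f : X → ℝ) : Prop :=
  ∃ (I : ℕ) (κ : Fin I → Kernel X X), 1 ≤ I ∧
    (∀ i, IsMarkovKernel (κ i)) ∧ (∀ i, (κ i).IsReversible π) ∧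
    P = composeSteps I κ ∧
    ∀ x ∈ R₀, ∫⁻ y, ENNReal.ofReal (f y) ∂(composeSteps I fun i => restrictedStep (κ i) R₀ hR₀) x
      ≤ ∫⁻ y, ENNReal.ofReal (f y) ∂P x

/-- The generalized drift condition for the kernel `P` with stationary distribution `π`, on the
large set `R₀`, with drift function `f ≥ 0` and constants `lam`, `b`. -/
structure GeneralizedDrift {X : Type*} [MeasurableSpace X] (P : Kernel X X) (π : Measure X)
    (R₀ : Set X) (hR₀ : MeasurableSet R₀) (f : X → ℝ) (lam b : ℝ) : Prop where
  measurable : Measurable f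
  nonneg : ∀ x, 0 ≤ f x
  drift : ∀ x ∈ R₀, Integrable f (P x) ∧ ∫ y, f y ∂P x ≤ lam * f x + b
  alternative : LargeSetIsSublevel f R₀ ∨ ReversibleStepsCondition P π R₀ hR₀ f

end

/-! No coupling is constructed. If `g x - g y ≤ w x + w y` for all `x`, `y`, then some constant `t`
satisfies `|g - t| ≤ w`. The means of `g` under two laws then differ by at most the sum of the two
means of `w`, less `2 * ε * ∫ w dQ` when both laws dominate `ε Q` (`integral_sub_le_of_minorized`).

`kernel_pow_real_sub_le` iterates this by induction on time, with `w` made of expected visits to the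
complement of the large set, a power of `1 - ε`, and an affine function of `f`. From a pair in the
large set with `f x + f y ≥ d`, the drift makes the mean of `1 + f + f` drop by a factor `α`; from a
pair with `f x + f y ≤ d`, that mean is at most `Λ` and the minorization yields a factor `1 - ε`.

Integrating over `ν` and `π` requires `(1 - lam) * ∫ f dπ ≤ b * π(R₀)`, the integral being over
`R₀`. For a sublevel set this follows from invariance applied to a truncation of `f`; for reversible
steps, the restricted sweep preserves `π` restricted to `R₀` and inherits the drift inequality. -/

/-! ### Drift inequalities and invariant measures. -/

/-- If the mean of `f` after one step from a point of `S` is at most `lam * f + b`, and points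
reached from `S` have values of `f` above any lower bound of `f` on `S`, then `b` is at least
`(1 - lam)` times the infimum of `f` on `S`. -/
lemma drift_constant_nonneg {X : Type*} [MeasurableSpace X] {K : Kernel X X} [IsMarkovKernel K]
    {S : Set X} (hS : S.Nonempty) {f : X → ℝ} (h0 : ∀ x, 0 ≤ f x) {lam b : ℝ}
    (hlam0 : 0 ≤ lam) (hlam1 : lam < 1)
    (hdrift : ∀ x ∈ S, Integrable f (K x) ∧ ∫ y, f y ∂K x ≤ lam * f x + b)
    (hout : ∀ m, (∀ y ∈ S, m ≤ f y) → ∀ x ∈ S, ∀ᵐ y ∂K x, m ≤ f y) :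
    0 ≤ b ∧ ∀ c, b < (1 - lam) * c → ∃ x ∈ S, f x < c := by
  set m := sInf (f '' S) with hm
  have hbdd : BddBelow (f '' S) := ⟨0, by rintro _ ⟨x, -, rfl⟩; exact h0 x⟩
  have hne : (f '' S).Nonempty := hS.image f
  have hm0 : 0 ≤ m := le_csInf hne (by rintro _ ⟨x, -, rfl⟩; exact h0 x)
  have hle : ∀ y ∈ S, m ≤ f y := fun y hy => csInf_le hbdd ⟨y, hy, rfl⟩
  have hstep : ∀ x ∈ S, m ≤ lam * f x + b := by
    intro x hx
    obtain ⟨hi, hd⟩ := hdrift x hx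
    refine le_trans ?_ hd
    have := integral_mono_ae (integrable_const m) hi (hout m hle x hx)
    simpa using this
  have hb : (1 - lam) * m ≤ b := by
    refine le_of_forall_pos_le_add fun e he => ?_
    obtain ⟨_, ⟨x, hx, rfl⟩, hxe⟩ := exists_lt_of_csInf_lt hne (show sInf (f '' S) < m + e by linarith)
    have := hstep x hx
    nlinarith
  refine ⟨by nlinarith, fun c hc => ?_⟩
  have hmc : m < c := by
    by_contra! h
    nlinarith
  obtain ⟨_, ⟨x, hx, rfl⟩, hxc⟩ := exists_lt_of_csInf_lt hne hmc
  exact ⟨x, hx, hxc⟩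

lemma integral_bind_kernel {X Y : Type*} [MeasurableSpace X] [MeasurableSpace Y]
    {K : Kernel X Y} [IsSFiniteKernel K] {μ : Measure X} [SFinite μ] {g : Y → ℝ}
    (hg : Integrable g (μ.bind K)) : ∫ y, g y ∂μ.bind K = ∫ x, ∫ y, g y ∂K x ∂μ := by
  have h : (K ∘ₖ Kernel.const Unit μ) () = μ.bind K := by rw [Kernel.comp_const]; rfl
  have := Kernel.integral_comp (κ := Kernel.const Unit μ) (η := K) (a := ()) (f := g)
    (by rwa [h])
  rwa [h, Kernel.const_apply] at this

/-- The mean of a drift function on one of its sublevel sets, for an invariant measure. -/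
lemma setIntegral_sublevel_le {X : Type*} [MeasurableSpace X] {K : Kernel X X} [IsMarkovKernel K]
    {μ : Measure X} [IsFiniteMeasure μ] (hK : K.Invariant μ) {f : X → ℝ} (hf : Measurable f)
    (h0 : ∀ x, 0 ≤ f x) {lam b M : ℝ} (hM : 0 ≤ M)
    (hdrift : ∀ᵐ x ∂μ, f x ≤ M → Integrable f (K x) ∧ ∫ y, f y ∂K x ≤ lam * f x + b) :
    (1 - lam) * ∫ x in {x | f x ≤ M}, f x ∂μ ≤ b * μ.real {x | f x ≤ M} := by
  set S := {x | f x ≤ M} with hS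
  have hSm : MeasurableSet S := measurableSet_le hf measurable_const
  -- Invariance is applied to the truncation `min f M`, which is bounded. Off `S` it equals its
  -- maximum `M`, so one step cannot increase its mean there; the contributions of `Sᶜ` cancel and
  -- only the drift on `S` remains.
  have hφm : Measurable fun x => min (f x) M := hf.min measurable_const
  have hφb : ∀ x, ‖min (f x) M‖ ≤ M := fun x => by
    rw [Real.norm_of_nonneg (le_min (h0 x) hM)]; exact min_le_right _ _
  have hφi : ∀ (ρ : Measure X) [IsFiniteMeasure ρ], Integrable (fun x => min (f x) M) ρ :=
    fun ρ _ => Integrable.of_bound hφm.aestronglyMeasurable M (ae_of_all _ hφb)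
  have hFi : Integrable (fun x => ∫ y, min (f y) M ∂K x) μ := by
    refine Integrable.of_bound (C := M)
      (StronglyMeasurable.integral_kernel hφm.stronglyMeasurable).aestronglyMeasurable
      (ae_of_all _ fun x => ?_)
    simpa using norm_integral_le_of_norm_le_const (μ := K x) (ae_of_all _ hφb)
  have hfS : IntegrableOn f S μ := by
    refine Measure.integrableOn_of_bounded (M := M) (measure_ne_top _ _) hf.aestronglyMeasurable ?_
    filter_upwards [ae_restrict_mem hSm] with x hx
    rwa [Real.norm_of_nonneg (h0 x)]
  have hinv : ∫ x, min (f x) M ∂μ = ∫ x, ∫ y, min (f y) M ∂K x ∂μ := by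
    conv_lhs => rw [← hK.def]
    exact integral_bind_kernel (by rw [hK.def]; exact hφi μ)
  rw [← integral_add_compl hSm (hφi μ), ← integral_add_compl hSm hFi] at hinv
  have e1 : ∫ x in S, min (f x) M ∂μ = ∫ x in S, f x ∂μ :=
    setIntegral_congr_fun hSm fun x hx => min_eq_left hx
  have e2 : ∫ x in Sᶜ, min (f x) M ∂μ = M * μ.real Sᶜ := by
    rw [setIntegral_congr_fun hSm.compl (g := fun _ => M)
      fun x hx => min_eq_right (le_of_lt (not_le.1 hx))]
    simp [mul_comm]
  have e3 : ∫ x in S, ∫ y, min (f y) M ∂K x ∂μ ≤ ∫ x in S, (lam * f x + b) ∂μ := by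
    refine setIntegral_mono_on_ae hFi.integrableOn
      ((hfS.const_mul lam).add (integrable_const b)) hSm ?_
    filter_upwards [hdrift] with x hx hxS
    obtain ⟨hi, hd⟩ := hx hxS
    exact (integral_mono (hφi _) hi fun y => min_le_left _ _).trans hd
  have e4 : ∫ x in Sᶜ, ∫ y, min (f y) M ∂K x ∂μ ≤ M * μ.real Sᶜ := by
    refine (setIntegral_mono hFi.integrableOn (integrable_const M).integrableOn
      fun x => ?_).trans_eq (by simp [mul_comm])
    simpa using integral_mono (hφi (K x)) (integrable_const M) fun y => min_le_right _ _
  have e5 : ∫ x in S, (lam * f x + b) ∂μ = lam * ∫ x in S, f x ∂μ + b * μ.real S := by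
    rw [integral_add (hfS.const_mul lam) (integrable_const b), integral_const_mul]
    simp [mul_comm]
  linarith

/-! ### Restricted steps and the stationary mean of `f` on the large set. -/

instance isMarkovKernel_restrictedStep {X : Type*} [MeasurableSpace X] (κ : Kernel X X)
    [IsMarkovKernel κ] (R₀ : Set X) (hR₀ : MeasurableSet R₀) :
    IsMarkovKernel (restrictedStep κ R₀ hR₀) := by
  refine ⟨fun x => ⟨?_⟩⟩
  change ((κ x).restrict R₀ + κ x R₀ᶜ • Measure.dirac x) Set.univ = 1
  simp [prob_add_prob_compl hR₀]

lemma isMarkovKernel_composeSteps {X : Type*} [MeasurableSpace X] :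
    ∀ (I : ℕ) (κ : Fin I → Kernel X X), (∀ i, IsMarkovKernel (κ i)) →
      IsMarkovKernel (composeSteps I κ)
  | 0, _, _ => by unfold composeSteps; infer_instance
  | I + 1, κ, h => by
    have := isMarkovKernel_composeSteps I (fun i => κ i.castSucc) fun i => h _
    have := h (Fin.last I)
    unfold composeSteps
    infer_instance

lemma invariant_composeSteps {X : Type*} [MeasurableSpace X] {μ : Measure X} :
    ∀ (I : ℕ) (κ : Fin I → Kernel X X), (∀ i, (κ i).Invariant μ) →
      (composeSteps I κ).Invariant μ
  | 0, _, _ => by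
    unfold composeSteps Kernel.Invariant
    exact Measure.id_comp
  | I + 1, κ, h => (h (Fin.last I)).comp
      (invariant_composeSteps I (fun i => κ i.castSucc) fun i => h _)

lemma composeSteps_compl_eq_zero {X : Type*} [MeasurableSpace X] {S : Set X}
    (hS : MeasurableSet S) :
    ∀ (I : ℕ) (κ : Fin I → Kernel X X), (∀ i, ∀ x ∈ S, κ i x Sᶜ = 0) →
      ∀ x ∈ S, composeSteps I κ x Sᶜ = 0
  | 0, _, _, x, hx => by
    unfold composeSteps
    rw [Kernel.id_apply, Measure.dirac_apply' _ hS.compl]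
    simp [hx]
  | I + 1, κ, h, x, hx => by
    unfold composeSteps
    rw [Kernel.comp_apply' _ _ _ hS.compl]
    have h1 := composeSteps_compl_eq_zero hS I (fun i => κ i.castSucc) (fun i => h _) x hx
    rw [lintegral_eq_zero_iff (Kernel.measurable_coe _ hS.compl)]
    filter_upwards [measure_eq_zero_iff_ae_notMem.1 h1] with y hy
    exact h _ y (by simpa using hy)

lemma restrictedStep_apply {X : Type*} [MeasurableSpace X] (κ : Kernel X X) {R₀ : Set X}
    (hR₀ : MeasurableSet R₀) (x : X) {B : Set X} (hB : MeasurableSet B) :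
    restrictedStep κ R₀ hR₀ x B = κ x (B ∩ R₀) + κ x R₀ᶜ * B.indicator 1 x := by
  change ((κ x).restrict R₀ + κ x R₀ᶜ • Measure.dirac x) B = _
  simp [Measure.restrict_apply hB, Measure.dirac_apply' _ hB]

lemma restrictedStep_compl_eq_zero {X : Type*} [MeasurableSpace X] (κ : Kernel X X) {R₀ : Set X}
    (hR₀ : MeasurableSet R₀) {x : X} (hx : x ∈ R₀) : restrictedStep κ R₀ hR₀ x R₀ᶜ = 0 := by
  rw [restrictedStep_apply κ hR₀ x hR₀.compl]
  simp [hx]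

/-- Restricting the steps of a reversible kernel to `R₀` leaves the restriction of the reversing
measure invariant. -/
lemma invariant_restrictedStep {X : Type*} [MeasurableSpace X] {κ : Kernel X X}
    [IsMarkovKernel κ] {π : Measure X} (hκ : κ.IsReversible π) {R₀ : Set X}
    (hR₀ : MeasurableSet R₀) : (restrictedStep κ R₀ hR₀).Invariant (π.restrict R₀) := by
  ext B hB
  rw [Measure.bind_apply hB (Kernel.aemeasurable _)]
  simp_rw [restrictedStep_apply κ hR₀ _ hB]
  have h2 : ∀ x, κ x R₀ᶜ * B.indicator 1 x = B.indicator (fun x => κ x R₀ᶜ) x := fun x => by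
    by_cases hx : x ∈ B <;> simp [hx]
  simp_rw [h2]
  -- Reversibility turns the flow from `R₀` into `B ∩ R₀` into the flow from `B ∩ R₀` into `R₀`; the
  -- rejected moves supply the flow from `B ∩ R₀` to `R₀ᶜ`, and the two probabilities add to one.
  rw [lintegral_add_left (Kernel.measurable_coe _ (hB.inter hR₀)), lintegral_indicator hB,
    Measure.restrict_restrict hB, hκ hR₀ (hB.inter hR₀),
    ← lintegral_add_left (Kernel.measurable_coe _ hR₀)]
  simp [prob_add_prob_compl hR₀, Measure.restrict_apply hB]

/-- The restricted sweep never leaves `R₀`, preserves `π.restrict R₀`, and satisfies the same drift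
inequality because its mean of `f` is no larger than that of `P`. -/
lemma restricted_integral_le_of_reversible {X : Type*} [MeasurableSpace X]
    {P : Kernel X X} [IsMarkovKernel P] {π : Measure X} [IsProbabilityMeasure π] {R₀ : Set X}
    {hR₀ : MeasurableSet R₀} (hne : R₀.Nonempty) {f : X → ℝ} {lam b : ℝ} (hlam0 : 0 ≤ lam)
    (hlam1 : lam < 1) (hf : Measurable f) (h0 : ∀ x, 0 ≤ f x)
    (hdrift : ∀ x ∈ R₀, Integrable f (P x) ∧ ∫ y, f y ∂P x ≤ lam * f x + b)
    (hrev : ReversibleStepsCondition P π R₀ hR₀ f) :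
    0 ≤ b ∧ (∀ c, b < (1 - lam) * c → ∃ x ∈ R₀, f x < c) ∧ IntegrableOn f R₀ π ∧
      (1 - lam) * ∫ x in R₀, f x ∂π ≤ b * π.real R₀ := by
  obtain ⟨I, κ, -, hM, hr, -, hle⟩ := hrev
  set K := composeSteps I fun i => restrictedStep (κ i) R₀ hR₀ with hKdef
  have hKM : IsMarkovKernel K := isMarkovKernel_composeSteps I _ fun i => inferInstance
  have hK : K.Invariant (π.restrict R₀) :=
    invariant_composeSteps I _ fun i => invariant_restrictedStep (hr i) hR₀
  have hK0 : ∀ x ∈ R₀, K x R₀ᶜ = 0 := composeSteps_compl_eq_zero hR₀ I _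
    fun i x hx => restrictedStep_compl_eq_zero (κ i) hR₀ hx
  have hKd : ∀ x ∈ R₀, Integrable f (K x) ∧ ∫ y, f y ∂K x ≤ lam * f x + b := by
    intro x hx
    obtain ⟨hi, hd⟩ := hdrift x hx
    have hfin : ∫⁻ y, ENNReal.ofReal (f y) ∂P x ≠ ∞ :=
      (lintegral_ofReal_ne_top_iff_integrable hf.aestronglyMeasurable (ae_of_all _ h0)).2 hi
    have hi' : Integrable f (K x) :=
      (lintegral_ofReal_ne_top_iff_integrable hf.aestronglyMeasurable (ae_of_all _ h0)).1
        (ne_top_of_le_ne_top hfin (hle x hx))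
    refine ⟨hi', le_trans ?_ hd⟩
    rw [integral_eq_lintegral_of_nonneg_ae (ae_of_all _ h0) hf.aestronglyMeasurable,
      integral_eq_lintegral_of_nonneg_ae (ae_of_all _ h0) hf.aestronglyMeasurable]
    exact ENNReal.toReal_mono hfin (hle x hx)
  obtain ⟨hb, hc⟩ := drift_constant_nonneg hne h0 hlam0 hlam1 hKd fun m hm x hx => by
    filter_upwards [measure_eq_zero_iff_ae_notMem.1 (hK0 x hx)] with y hy
    exact hm y (by simpa using hy)
  -- `f` is not known to be integrable on `R₀`: this comes from bounds on the sets `f ≤ n` that are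
  -- uniform in `n`.
  have hcov : AECover (π.restrict R₀) Filter.atTop fun n : ℕ => {x | f x ≤ n} := by
    refine ⟨ae_of_all _ fun x => ?_, fun n => measurableSet_le hf measurable_const⟩
    filter_upwards [Filter.eventually_ge_atTop ⌈f x⌉₊] with n hn
    exact Nat.ceil_le.1 hn
  have hint : ∀ n : ℕ, IntegrableOn f {x | f x ≤ n} (π.restrict R₀) := fun n => by
    refine Measure.integrableOn_of_bounded (M := n) (measure_ne_top _ _) hf.aestronglyMeasurable ?_
    filter_upwards [ae_restrict_mem (measurableSet_le hf measurable_const)] with x hx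
    rwa [Real.norm_of_nonneg (h0 x)]
  have hbound : ∀ n : ℕ, ∫ x in {x | f x ≤ n}, f x ∂π.restrict R₀ ≤ b * π.real R₀ / (1 - lam) := by
    intro n
    rw [le_div_iff₀ (by linarith), mul_comm]
    refine (setIntegral_sublevel_le (b := b) (M := n) hK hf h0 (Nat.cast_nonneg n) ?_).trans ?_
    · filter_upwards [ae_restrict_mem hR₀] with x hx _ using hKd x hx
    · refine mul_le_mul_of_nonneg_left ?_ hb
      refine (measureReal_mono (Set.subset_univ _)).trans_eq (by simp [Measure.real])
  have hfi : Integrable f (π.restrict R₀) :=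
    hcov.integrable_of_integral_bounded_of_nonneg_ae _ hint (ae_of_all _ h0)
      (Filter.Eventually.of_forall hbound)
  refine ⟨hb, hc, hfi, ?_⟩
  have := le_of_tendsto' (hcov.integral_tendsto_of_countably_generated hfi) hbound
  rwa [le_div_iff₀ (by linarith), mul_comm] at this

/-- Outside a sublevel set `f` exceeds all its values inside, so leaving `R₀` cannot undercut a
lower bound of `f` on `R₀`, and truncation at `d₀` suffices. -/
lemma restricted_integral_le_of_sublevel {X : Type*} [MeasurableSpace X]
    {P : Kernel X X} [IsMarkovKernel P] {π : Measure X} [IsProbabilityMeasure π]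
    (hπ : P.Invariant π) {R₀ : Set X}
    (hR₀ : MeasurableSet R₀) (hne : R₀.Nonempty) {f : X → ℝ} {lam b : ℝ} (hlam0 : 0 ≤ lam)
    (hlam1 : lam < 1) (hf : Measurable f) (h0 : ∀ x, 0 ≤ f x)
    (hdrift : ∀ x ∈ R₀, Integrable f (P x) ∧ ∫ y, f y ∂P x ≤ lam * f x + b)
    (hsub : LargeSetIsSublevel f R₀) :
    0 ≤ b ∧ (∀ c, b < (1 - lam) * c → ∃ x ∈ R₀, f x < c) ∧ IntegrableOn f R₀ π ∧
      (1 - lam) * ∫ x in R₀, f x ∂π ≤ b * π.real R₀ := by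
  obtain ⟨d₀, hd₀, rfl⟩ := hsub
  obtain ⟨hb, hc⟩ := drift_constant_nonneg hne h0 hlam0 hlam1 hdrift fun m hm x hx =>
    ae_of_all _ fun y => by
      by_cases hy : f y ≤ d₀
      · exact hm y hy
      · exact (hm x hx).trans (le_trans hx (not_le.1 hy).le)
  refine ⟨hb, hc, ?_, setIntegral_sublevel_le hπ hf h0 hd₀.le (ae_of_all _ hdrift)⟩
  refine Measure.integrableOn_of_bounded (M := d₀) (measure_ne_top _ _) hf.aestronglyMeasurable ?_
  filter_upwards [ae_restrict_mem hR₀] with x hx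
  rwa [Real.norm_of_nonneg (h0 x)]

/-! ### Powers of the kernel and expected visits. -/

lemma isMarkovKernel_pow {X : Type*} [MeasurableSpace X] (P : Kernel X X) [IsMarkovKernel P] :
    ∀ n : ℕ, IsMarkovKernel (P ^ n)
  | 0 => by
    rw [pow_zero]
    exact inferInstanceAs (IsMarkovKernel (Kernel.id : Kernel X X))
  | n + 1 => by
    have := isMarkovKernel_pow P n
    rw [pow_succ]
    exact inferInstanceAs (IsMarkovKernel ((P ^ n) ∘ₖ P))

lemma invariant_pow {X : Type*} [MeasurableSpace X] {P : Kernel X X} {π : Measure X}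
    (hπ : P.Invariant π) : ∀ n : ℕ, (P ^ n).Invariant π
  | 0 => by
    rw [pow_zero]
    exact Measure.id_comp
  | n + 1 => by
    rw [pow_succ]
    exact (invariant_pow hπ n).comp hπ

lemma measurable_kernel_real {X Y : Type*} [MeasurableSpace X] [MeasurableSpace Y]
    (K : Kernel X Y) {B : Set Y} (hB : MeasurableSet B) : Measurable fun x => (K x).real B :=
  (K.measurable_coe hB).ennreal_toReal

lemma integrable_kernel_real {X Y : Type*} [MeasurableSpace X] [MeasurableSpace Y]
    (K : Kernel X Y) [IsMarkovKernel K] (μ : Measure X) [IsFiniteMeasure μ] {B : Set Y}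
    (hB : MeasurableSet B) : Integrable (fun x => (K x).real B) μ :=
  Integrable.of_bound (measurable_kernel_real K hB).aestronglyMeasurable 1
    (ae_of_all _ fun x => by rw [Real.norm_of_nonneg measureReal_nonneg]; exact measureReal_le_one)

lemma bind_kernel_real {X Y : Type*} [MeasurableSpace X] [MeasurableSpace Y]
    (K : Kernel X Y) [IsMarkovKernel K] (μ : Measure X) {B : Set Y}
    (hB : MeasurableSet B) : (μ.bind K).real B = ∫ x, (K x).real B ∂μ := by
  rw [Measure.real, Measure.bind_apply hB K.aemeasurable]
  exact (integral_toReal (K.measurable_coe hB).aemeasurable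
    (ae_of_all _ fun x => measure_lt_top _ _)).symm

lemma pow_succ_kernel_real {X : Type*} [MeasurableSpace X] (P : Kernel X X) [IsMarkovKernel P]
    (n : ℕ) (x : X) {B : Set X} (hB : MeasurableSet B) :
    ((P ^ (n + 1)) x).real B = ∫ y, ((P ^ n) y).real B ∂P x := by
  have := isMarkovKernel_pow P n
  rw [← bind_kernel_real (P ^ n) (P x) hB, pow_succ]
  rfl

lemma pow_zero_kernel_real {X : Type*} [MeasurableSpace X] (P : Kernel X X)
    (x : X) {B : Set X} (hB : MeasurableSet B) :
    ((P ^ 0) x).real B = B.indicator 1 x := by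
  rw [pow_zero]
  change ((Kernel.id : Kernel X X) x).real B = _
  rw [Kernel.id_apply, Measure.real, Measure.dirac_apply' _ hB]
  by_cases hx : x ∈ B <;> simp [hx]

/-- The expected number of the first `n` times at which the chain started at `x` is in `A`. -/
noncomputable def expectedVisits {X : Type*} [MeasurableSpace X] (P : Kernel X X) (A : Set X)
    (n : ℕ) (x : X) : ℝ :=
  ∑ i ∈ Finset.range n, ((P ^ i) x).real A

lemma expectedVisits_nonneg {X : Type*} [MeasurableSpace X] (P : Kernel X X) (A : Set X)
    (n : ℕ) (x : X) : 0 ≤ expectedVisits P A n x :=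
  Finset.sum_nonneg fun _ _ => measureReal_nonneg

lemma integral_expectedVisits_nonneg {X : Type*} [MeasurableSpace X] (P : Kernel X X) (A : Set X)
    (n : ℕ) (μ : Measure X) : 0 ≤ ∫ x, expectedVisits P A n x ∂μ :=
  integral_nonneg fun x => expectedVisits_nonneg P A n x

lemma integrable_expectedVisits {X : Type*} [MeasurableSpace X] (P : Kernel X X)
    [IsMarkovKernel P] {A : Set X} (hA : MeasurableSet A) (n : ℕ) (μ : Measure X)
    [IsFiniteMeasure μ] : Integrable (expectedVisits P A n) μ := by
  refine integrable_finsetSum _ fun i _ => ?_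
  have := isMarkovKernel_pow P i
  exact integrable_kernel_real (P ^ i) μ hA

lemma expectedVisits_succ {X : Type*} [MeasurableSpace X] (P : Kernel X X)
    [IsMarkovKernel P] {A : Set X} (hA : MeasurableSet A) (n : ℕ) (x : X) :
    expectedVisits P A (n + 1) x = A.indicator 1 x + ∫ y, expectedVisits P A n y ∂P x := by
  have h := fun i => isMarkovKernel_pow P i
  unfold expectedVisits
  rw [Finset.sum_range_succ', integral_finsetSum _ fun i _ => integrable_kernel_real (P ^ i) _ hA,
    pow_zero_kernel_real P x hA, add_comm]
  simp_rw [pow_succ_kernel_real P _ x hA]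

/-! ### Separable bounds in place of couplings. -/

/-- With `u = g - w` and `v = g + w`, this splits a bound on pairs into two one-variable bounds
around a common centre `t`. -/
lemma exists_between_of_forall_forall_le {X : Type*} [Nonempty X] {u v : X → ℝ}
    (h : ∀ x y, u x ≤ v y) : ∃ t, ∀ x, u x ≤ t ∧ t ≤ v x := by
  obtain ⟨x₀⟩ := ‹Nonempty X›
  have : Nonempty X := ⟨x₀⟩
  exact ⟨⨆ x, u x, fun x => ⟨le_ciSup (f := u) ⟨v x₀, by rintro _ ⟨y, rfl⟩; exact h y x₀⟩ x,
    ciSup_le fun y => h y x⟩⟩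

lemma integrable_of_smul_le {X : Type*} [MeasurableSpace X] {μ Q : Measure X} {ε : ℝ}
    (hε : 0 < ε) (h : ENNReal.ofReal ε • Q ≤ μ) {u : X → ℝ} (hu : Integrable u μ) :
    Integrable u Q :=
  (integrable_smul_measure (by simpa using hε) ENNReal.ofReal_ne_top).1 (hu.mono_measure h)

lemma mul_integral_le_of_smul_le {X : Type*} [MeasurableSpace X] {μ Q : Measure X} {ε : ℝ}
    (hε : 0 ≤ ε) (h : ENNReal.ofReal ε • Q ≤ μ) {u : X → ℝ} (hu : Integrable u μ)
    (h0 : ∀ x, 0 ≤ u x) : ε * ∫ x, u x ∂Q ≤ ∫ x, u x ∂μ := by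
  have := integral_mono_measure h (ae_of_all _ h0) hu
  rwa [integral_smul_measure, ENNReal.toReal_ofReal hε, smul_eq_mul] at this

/-- Two probability measures with a common component: a separable bound on the differences of the
values of `g` bounds the difference of the means of `g`. -/
lemma integral_sub_le_of_minorized {X : Type*} [MeasurableSpace X] {μ₁ μ₂ Q : Measure X}
    [IsProbabilityMeasure μ₁] [IsProbabilityMeasure μ₂] [IsProbabilityMeasure Q] {ε : ℝ}
    (hε : 0 ≤ ε) (h₁ : ENNReal.ofReal ε • Q ≤ μ₁) (h₂ : ENNReal.ofReal ε • Q ≤ μ₂) {g w : X → ℝ}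
    (hg₁ : Integrable g μ₁) (hg₂ : Integrable g μ₂) (hgQ : Integrable g Q)
    (hw₁ : Integrable w μ₁) (hw₂ : Integrable w μ₂) (hwQ : Integrable w Q)
    (hgw : ∀ x y, g x - g y ≤ w x + w y) :
    ∫ x, g x ∂μ₁ - ∫ x, g x ∂μ₂ ≤ ∫ x, w x ∂μ₁ + ∫ x, w x ∂μ₂ - 2 * ε * ∫ x, w x ∂Q := by
  have : Nonempty X := nonempty_of_isProbabilityMeasure Q
  obtain ⟨t, ht⟩ := exists_between_of_forall_forall_le (u := fun x => g x - w x)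
    (v := fun x => g x + w x) fun x y => by linarith [hgw x y]
  -- The nonnegative functions `t + w - g` and `g + w - t` add up to `2 * w`, so their integrals
  -- over the common part `ε Q` produce the saving.
  have e1 := mul_integral_le_of_smul_le hε h₁ (u := fun x => t + w x - g x)
    (((integrable_const t).add hw₁).sub hg₁) fun x => by linarith [(ht x).1]
  have e2 := mul_integral_le_of_smul_le hε h₂ (u := fun x => g x + w x - t)
    ((hg₂.add hw₂).sub (integrable_const t)) fun x => by linarith [(ht x).2]
  have a1 : ∀ (ρ : Measure X) [IsProbabilityMeasure ρ], Integrable g ρ → Integrable w ρ →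
      ∫ x, (t + w x - g x) ∂ρ = t + ∫ x, w x ∂ρ - ∫ x, g x ∂ρ := fun ρ _ hg hw => by
    rw [integral_sub (by fun_prop) hg, integral_add (integrable_const t) hw]
    simp
  have a2 : ∀ (ρ : Measure X) [IsProbabilityMeasure ρ], Integrable g ρ → Integrable w ρ →
      ∫ x, (g x + w x - t) ∂ρ = ∫ x, g x ∂ρ + ∫ x, w x ∂ρ - t := fun ρ _ hg hw => by
    rw [integral_sub (by fun_prop) (integrable_const t), integral_add hg hw]
    simp
  rw [a1 _ hgQ hwQ, a1 _ hg₁ hw₁] at e1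
  rw [a2 _ hgQ hwQ, a2 _ hg₂ hw₂] at e2
  linarith

/-! ### The induction on time. -/

/-- The bound, in terms of the states `x` and `y` of two chains, on the difference of their laws
after `n` steps: visits to the complement of `S`, the failure of `l + 1` attempts to couple, and
the event that fewer attempts are made. -/
theorem kernel_pow_real_sub_le {X : Type*} [MeasurableSpace X] {P : Kernel X X} [IsMarkovKernel P]
    {S : Set X} (hS : MeasurableSet S) {f : X → ℝ} (h0 : ∀ x, 0 ≤ f x) {lam b d ε α Λ : ℝ}
    (hdrift : ∀ x ∈ S, Integrable f (P x) ∧ ∫ y, f y ∂P x ≤ lam * f x + b)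
    {Q : Measure X} [IsProbabilityMeasure Q] (hε0 : 0 < ε) (hε1 : ε ≤ 1)
    (hminor : ∀ x, f x ≤ d → ENNReal.ofReal ε • Q ≤ P x)
    (hα : 1 ≤ α) (hΛ : 1 ≤ Λ)
    (hfar : ∀ s, d ≤ s → α * (1 + lam * s + 2 * b) ≤ 1 + s)
    (hnear : ∀ s, s ≤ d → 1 + lam * s + 2 * b ≤ Λ)
    {c T : ℝ} (hc : 0 < c) (hcT : c < T) {B : Set X} (hB : MeasurableSet B) (n : ℕ) :
    ∀ (l : ℕ) (a : ℝ), c * Λ ^ l ≤ a → T * (α * Λ) ^ l ≤ a * α ^ n → ∀ x y,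
      ((P ^ n) x).real B - ((P ^ n) y).real B ≤
        expectedVisits P Sᶜ n x + expectedVisits P Sᶜ n y + (1 - ε) ^ (l + 1)
          + (a * (1 + f x + f y) - c) / (T - c) := by
  have hpow := fun i => isMarkovKernel_pow P i
  have hTc : 0 < T - c := by linarith
  have hone : ∀ l : ℕ, 1 ≤ Λ ^ l := fun l => one_le_pow₀ hΛ
  have hca : ∀ {l : ℕ} {a : ℝ}, c * Λ ^ l ≤ a → c ≤ a := fun {l a} h => by
    nlinarith [hone l]
  have hG : ∀ {a : ℝ}, c ≤ a → ∀ x y, 0 ≤ (a * (1 + f x + f y) - c) / (T - c) := by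
    intro a ha x y
    have := mul_nonneg (hc.le.trans ha) (add_nonneg (h0 x) (h0 y))
    exact div_nonneg (by nlinarith) hTc.le
  have hle1 : ∀ (m : ℕ) x y, ((P ^ m) x).real B - ((P ^ m) y).real B ≤ 1 := fun m x y => by
    have h1 : ((P ^ m) x).real B ≤ 1 := measureReal_le_one
    have h2 : 0 ≤ ((P ^ m) y).real B := measureReal_nonneg
    linarith
  have heps : ∀ m : ℕ, 0 ≤ (1 - ε) ^ m := fun m => pow_nonneg (by linarith) m
  -- The weight `a` is multiplied by `α` at a far pair and divided by `Λ`, with `l` lowered, at a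
  -- near pair. Both hypotheses on `a` survive: the first keeps `a ≥ c`, so the last term stays
  -- nonnegative; the second forces `a ≥ T` at time `0`, so that term is then at least `1`.
  induction n with
  | zero =>
    intro l a ha1 ha2 x y
    refine (hle1 0 x y).trans ?_
    have h1 : 1 ≤ (α * Λ) ^ l := one_le_pow₀ (by nlinarith)
    have hT : T ≤ a := by
      simp only [pow_zero, mul_one] at ha2
      nlinarith
    have h2 : 1 ≤ (a * (1 + f x + f y) - c) / (T - c) := by
      rw [le_div_iff₀ hTc]
      have := mul_nonneg (hc.le.trans (hca ha1)) (add_nonneg (h0 x) (h0 y))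
      nlinarith
    linarith [heps (l + 1), expectedVisits_nonneg P Sᶜ 0 x, expectedVisits_nonneg P Sᶜ 0 y]
  | succ n ih =>
    intro l a ha1 ha2 x y
    have ha := hca ha1
    by_cases hxy : x ∈ S ∧ y ∈ S
    swap
    -- The visit to `Sᶜ` at time `0` already pays for the trivial bound `1`.
    · refine (hle1 _ x y).trans ?_
      have hv : ∀ z ∉ S, 1 ≤ expectedVisits P Sᶜ (n + 1) z := fun z hz => by
        rw [expectedVisits_succ P hS.compl, Set.indicator_of_mem hz]
        have := integral_expectedVisits_nonneg P Sᶜ n (P z)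
        simpa using this
      have := hG ha x y
      have := heps (l + 1)
      have := expectedVisits_nonneg P Sᶜ (n + 1) x
      have := expectedVisits_nonneg P Sᶜ (n + 1) y
      rcases not_and_or.1 hxy with h | h <;> linarith [hv _ h]
    obtain ⟨hx, hy⟩ := hxy
    obtain ⟨hfx, hdx⟩ := hdrift x hx
    obtain ⟨hfy, hdy⟩ := hdrift y hy
    rw [pow_succ_kernel_real P n x hB, pow_succ_kernel_real P n y hB,
      expectedVisits_succ P hS.compl, expectedVisits_succ P hS.compl,
      Set.indicator_of_notMem (by simpa using hx), Set.indicator_of_notMem (by simpa using hy),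
      zero_add, zero_add]
    have hgi : ∀ (ρ : Measure X) [IsProbabilityMeasure ρ],
        Integrable (fun z => ((P ^ n) z).real B) ρ :=
      fun ρ _ => integrable_kernel_real (P ^ n) ρ hB
    have hvi : ∀ (ρ : Measure X) [IsProbabilityMeasure ρ], Integrable (expectedVisits P Sᶜ n) ρ :=
      fun ρ _ => integrable_expectedVisits P hS.compl n ρ
    have hGi : ∀ (ρ : Measure X) [IsProbabilityMeasure ρ] (a' : ℝ), Integrable f ρ →
        Integrable (fun z => (a' * (1 + 2 * f z) - c) / (2 * (T - c))) ρ := fun ρ _ a' hf =>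
      ((((integrable_const _).add (hf.const_mul 2)).const_mul a').sub (integrable_const c)).div_const _
    have hwi : ∀ (ρ : Measure X) [IsProbabilityMeasure ρ] (q a' : ℝ), Integrable f ρ →
        Integrable (fun z => expectedVisits P Sᶜ n z + q / 2
          + (a' * (1 + 2 * f z) - c) / (2 * (T - c))) ρ := fun ρ _ q a' hf =>
      ((hvi ρ).add (integrable_const _)).add (hGi ρ a' hf)
    have hwe : ∀ (ρ : Measure X) [IsProbabilityMeasure ρ] (q a' : ℝ), Integrable f ρ →
        ∫ z, (expectedVisits P Sᶜ n z + q / 2 + (a' * (1 + 2 * f z) - c) / (2 * (T - c))) ∂ρ =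
          ∫ z, expectedVisits P Sᶜ n z ∂ρ + q / 2
            + (a' * (1 + 2 * ∫ z, f z ∂ρ) - c) / (2 * (T - c)) := fun ρ _ q a' hf => by
      have hv := hvi ρ
      have e : ∀ F : ℝ, (a' * (1 + 2 * F) - c) / (2 * (T - c)) =
          (a' - c) / (2 * (T - c)) + a' / (T - c) * F := fun F => by
        field_simp
        ring
      simp_rw [e, ← add_assoc]
      rw [integral_add (by fun_prop) (by fun_prop), integral_add (by fun_prop) (by fun_prop),
        integral_add (by fun_prop) (by fun_prop), integral_const_mul]
      simp
    have hsep : ∀ (a' q : ℝ) (u v : X), expectedVisits P Sᶜ n u + expectedVisits P Sᶜ n v + q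
        + (a' * (1 + f u + f v) - c) / (T - c) =
        (expectedVisits P Sᶜ n u + q / 2 + (a' * (1 + 2 * f u) - c) / (2 * (T - c))) +
        (expectedVisits P Sᶜ n v + q / 2 + (a' * (1 + 2 * f v) - c) / (2 * (T - c))) := by
      intro a' q u v
      field_simp
      ring
    have hcomb : ∀ a' A F G : ℝ, a' * (1 + F + G) ≤ A →
        (a' * (1 + 2 * F) - c) / (2 * (T - c)) + (a' * (1 + 2 * G) - c) / (2 * (T - c)) ≤
          (A - c) / (T - c) := by
      intro a' A F G h
      rw [← add_div, div_le_div_iff₀ (by linarith) hTc]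
      nlinarith
    rcases le_total d (f x + f y) with hs | hs
    · have hzero : ∀ {ρ : Measure X}, ENNReal.ofReal 0 • P x ≤ ρ := fun {ρ} => by
        rw [ENNReal.ofReal_zero, zero_smul]
        exact Measure.zero_le ρ
      have key := integral_sub_le_of_minorized (μ₁ := P x) (μ₂ := P y) (Q := P x) le_rfl
        hzero hzero (hgi _) (hgi _) (hgi _)
        (hwi _ ((1 - ε) ^ (l + 1)) (α * a) hfx) (hwi _ _ _ hfy) (hwi _ _ _ hfx)
        fun u v => (ih l (α * a) (by nlinarith) (by rw [pow_succ] at ha2; linarith) u v).trans_eq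
          (hsep _ _ u v)
      rw [hwe _ _ _ hfx, hwe _ _ _ hfy] at key
      have hA : α * a * (1 + ∫ z, f z ∂P x + ∫ z, f z ∂P y) ≤ a * (1 + f x + f y) := by
        have h1 := hfar _ hs
        have h2 : α * (1 + ∫ z, f z ∂P x + ∫ z, f z ∂P y) ≤ 1 + (f x + f y) :=
          le_trans (mul_le_mul_of_nonneg_left (by linarith) (by linarith)) h1
        nlinarith
      linarith [hcomb _ _ _ _ hA]
    · have hmx := hminor x (by linarith [h0 y])
      have hmy := hminor y (by linarith [h0 x])
      have hfQ := integrable_of_smul_le hε0 hmx hfx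
      cases l with
      | zero =>
        -- Last counted attempt: the trivial bound `1`, split as `1/2 + 1/2`, leaves `1 - ε`.
        have key := integral_sub_le_of_minorized (w := fun _ => (1 / 2 : ℝ)) hε0.le hmx hmy
          (hgi _) (hgi _) (hgi _) (integrable_const _) (integrable_const _) (integrable_const _)
          fun u v => (hle1 n u v).trans_eq (by norm_num)
        simp only [integral_const, probReal_univ, smul_eq_mul] at key
        have := hG ha x y
        have := integral_expectedVisits_nonneg P Sᶜ n (P x)
        have := integral_expectedVisits_nonneg P Sᶜ n (P y)
        simp only [zero_add, pow_one]
        linarith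
      | succ l =>
        have hΛ0 : 0 < Λ := by linarith
        have ha1' : c * Λ ^ l ≤ a / Λ := by
          rw [le_div_iff₀ hΛ0, mul_assoc, ← pow_succ]
          exact ha1
        have ha2' : T * (α * Λ) ^ l ≤ a / Λ * α ^ n := by
          rw [div_mul_eq_mul_div, le_div_iff₀ hΛ0]
          refine le_of_mul_le_mul_right ?_ (show 0 < α by linarith)
          calc T * (α * Λ) ^ l * Λ * α = T * (α * Λ) ^ (l + 1) := by ring
            _ ≤ a * α ^ (n + 1) := ha2
            _ = a * α ^ n * α := by ring
        have key := integral_sub_le_of_minorized hε0.le hmx hmy (hgi _) (hgi _) (hgi _)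
          (hwi _ ((1 - ε) ^ (l + 1)) (a / Λ) hfx) (hwi _ _ _ hfy) (hwi _ _ _ hfQ)
          fun u v => (ih l (a / Λ) ha1' ha2' u v).trans_eq (hsep _ _ u v)
        rw [hwe _ _ _ hfx, hwe _ _ _ hfy, hwe _ _ _ hfQ] at key
        have hA : a / Λ * (1 + ∫ z, f z ∂P x + ∫ z, f z ∂P y) ≤ a * (1 + f x + f y) := by
          have h1 := hnear _ hs
          have h2 : a / Λ * (1 + ∫ z, f z ∂P x + ∫ z, f z ∂P y) ≤ a / Λ * Λ :=
            mul_le_mul_of_nonneg_left (by linarith) (div_nonneg (hc.le.trans ha) hΛ0.le)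
          rw [div_mul_cancel₀ _ hΛ0.ne'] at h2
          have := mul_nonneg (hc.le.trans ha) (add_nonneg (h0 x) (h0 y))
          linarith
        -- Only the constant part of `w` is used in the saving over `Q`; it turns the power `l + 1`
        -- of `1 - ε` into `l + 2`. The other parts are nonnegative and dropped.
        have hQ : 0 ≤ ε * (∫ z, expectedVisits P Sᶜ n z ∂Q
            + (a / Λ * (1 + 2 * ∫ z, f z ∂Q) - c) / (2 * (T - c))) := by
          refine mul_nonneg hε0.le (add_nonneg ((integral_expectedVisits_nonneg P Sᶜ n Q))
            (div_nonneg ?_ (by linarith)))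
          have := hca ha1'
          have := mul_nonneg (hc.le.trans this) (integral_nonneg (μ := Q) h0)
          linarith
        have hp : (1 - ε) ^ (l + 1 + 1) = (1 - ε) ^ (l + 1) - ε * (1 - ε) ^ (l + 1) := by ring
        linarith [hcomb _ _ _ _ hA]

/-! ### Integration over the initial and stationary laws. -/

lemma integral_expectedVisits_eq {X : Type*} [MeasurableSpace X] (P : Kernel X X)
    [IsMarkovKernel P] {A : Set X} (hA : MeasurableSet A) (n : ℕ) (μ : Measure X)
    [IsFiniteMeasure μ] : ∫ x, expectedVisits P A n x ∂μ =
      ∑ i ∈ Finset.range n, ∫ x, ((P ^ i) x).real A ∂μ := by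
  have h := fun i => isMarkovKernel_pow P i
  exact integral_finsetSum _ fun i _ => integrable_kernel_real (P ^ i) _ hA

lemma integral_expectedVisits_le {X : Type*} [MeasurableSpace X] (P : Kernel X X)
    [IsMarkovKernel P] {A : Set X} (hA : MeasurableSet A) (k : ℕ) (ν : Measure X)
    [IsProbabilityMeasure ν] (hν : ν.real A = 0) :
    ∫ x, expectedVisits P A k x ∂ν ≤ ∑ i ∈ Finset.Icc 1 k, (ν.bind ⇑(P ^ i)).real A := by
  have h := fun i => isMarkovKernel_pow P i
  rw [integral_expectedVisits_eq P hA]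
  simp_rw [← fun i => bind_kernel_real (P ^ i) ν hA]
  have h0 : (ν.bind ⇑(P ^ 0)).real A = 0 := by
    rw [pow_zero]
    exact (congrArg (fun μ : Measure X => μ.real A) Measure.id_comp).trans hν
  calc ∑ i ∈ Finset.range k, (ν.bind ⇑(P ^ i)).real A
      ≤ ∑ i ∈ Finset.range (k + 1), (ν.bind ⇑(P ^ i)).real A :=
        Finset.sum_le_sum_of_subset_of_nonneg (Finset.range_mono (Nat.le_succ k))
          fun _ _ _ => measureReal_nonneg
    _ = ∑ i ∈ Finset.Icc 1 k, (ν.bind ⇑(P ^ i)).real A := by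
        rw [Finset.sum_range_succ', h0, add_zero,
          Finset.range_eq_Ico, Finset.sum_Ico_add' (fun i => (ν.bind ⇑(P ^ i)).real A) 0 k 1]
        rfl

/-- Starting in `S` removes the visit at time `0`, whence `k - 1`. The unit saved absorbs the
`π.real Sᶜ` lost in `integral_sub_integral_le`. -/
lemma setIntegral_expectedVisits_le {X : Type*} [MeasurableSpace X] {P : Kernel X X}
    [IsMarkovKernel P] {π : Measure X} [IsProbabilityMeasure π] (hπ : P.Invariant π) {S : Set X}
    (hS : MeasurableSet S) {k : ℕ} (hk : 1 ≤ k) :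
    ∫ x in S, expectedVisits P Sᶜ k x ∂π ≤ (k - 1) * π.real Sᶜ := by
  have h := fun i => isMarkovKernel_pow P i
  obtain ⟨k, rfl⟩ := Nat.exists_eq_add_of_le' hk
  rw [integral_expectedVisits_eq P hS.compl, Finset.sum_range_succ']
  have h0 : ∫ x in S, ((P ^ 0) x).real Sᶜ ∂π = 0 := by
    rw [setIntegral_congr_fun hS (g := fun _ => 0) fun x hx => ?_]
    · simp
    · rw [pow_zero_kernel_real P x hS.compl]
      simp [hx]
  have h1 : ∀ i ∈ Finset.range k, ∫ x in S, ((P ^ (i + 1)) x).real Sᶜ ∂π ≤ π.real Sᶜ :=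
    fun i _ => by
      refine (setIntegral_le_integral (integrable_kernel_real _ π hS.compl)
        (ae_of_all _ fun x => measureReal_nonneg)).trans_eq ?_
      rw [← bind_kernel_real _ π hS.compl, (invariant_pow hπ (i + 1)).def]
  have := Finset.sum_le_sum h1
  simp only [Finset.sum_const, Finset.card_range, nsmul_eq_mul] at this
  rw [h0]
  push_cast
  linarith

/-- A separable pointwise bound on the differences of the values of `g`, integrated. -/
lemma integral_sub_integral_le {X : Type*} [MeasurableSpace X] {ν π : Measure X}
    [IsProbabilityMeasure ν] [IsProbabilityMeasure π] {S : Set X} (hS : MeasurableSet S)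
    {g w : X → ℝ} (hg0 : ∀ x, 0 ≤ g x) (hg1 : ∀ x, g x ≤ 1) (hgν : Integrable g ν)
    (hgπ : Integrable g π) (hwν : Integrable w ν) (hwπ : IntegrableOn w S π)
    (hgw : ∀ x y, g x - g y ≤ w x + w y) :
    ∫ x, g x ∂ν - ∫ x, g x ∂π ≤
      π.real S * ∫ x, w x ∂ν + ∫ x in S, w x ∂π + π.real Sᶜ := by
  have : Nonempty X := nonempty_of_isProbabilityMeasure ν
  obtain ⟨t, ht⟩ := exists_between_of_forall_forall_le (u := fun x => g x - w x)
    (v := fun x => g x + w x) fun x y => by linarith [hgw x y]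
  have h1 : ∫ x, g x ∂ν ≤ t + ∫ x, w x ∂ν := by
    refine (integral_mono hgν ((integrable_const t).add hwν)
      fun x => show g x ≤ t + w x by linarith [(ht x).1]).trans_eq ?_
    simp only [Pi.add_apply]
    rw [integral_add (integrable_const t) hwν]
    simp
  have h2 : π.real S * t ≤ ∫ x in S, g x ∂π + ∫ x in S, w x ∂π := by
    rw [← integral_add hgπ.integrableOn hwπ]
    refine le_trans (by simp) (integral_mono (μ := π.restrict S) (integrable_const t)
      (hgπ.integrableOn.add hwπ) fun x => (ht x).2)
  have h3 : 0 ≤ ∫ x in Sᶜ, g x ∂π := integral_nonneg hg0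
  have h4 : ∫ x, g x ∂ν ≤ 1 := by
    simpa using integral_mono hgν (integrable_const (1 : ℝ)) hg1
  have h5 := probReal_compl_eq_one_sub (μ := π) hS
  have h6 : 0 ≤ π.real S := measureReal_nonneg
  have h7 : 0 ≤ π.real Sᶜ := measureReal_nonneg
  rw [← integral_add_compl hS hgπ]
  -- The mean of `g` under `ν` is split with weights `π.real S` and `π.real Sᶜ`: the first share is
  -- compared through `t`, the second is bounded by `1`.
  nlinarith

/-- The pairwise bound is averaged over `ν` and over `π` on `S` only, since `f` need not be
`π`-integrable elsewhere. -/
theorem bind_pow_real_sub_le {X : Type*} [MeasurableSpace X] {P : Kernel X X} [IsMarkovKernel P]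
    {π : Measure X} [IsProbabilityMeasure π] (hπ : P.Invariant π)
    {S : Set X} (hS : MeasurableSet S) {f : X → ℝ} (h0 : ∀ x, 0 ≤ f x) {lam b d ε α Λ : ℝ}
    (hlam1 : lam < 1)
    (hdrift : ∀ x ∈ S, Integrable f (P x) ∧ ∫ y, f y ∂P x ≤ lam * f x + b)
    (hfπ : IntegrableOn f S π) (hπf : (1 - lam) * ∫ x in S, f x ∂π ≤ b * π.real S)
    (hb : 0 ≤ b)
    {Q : Measure X} [IsProbabilityMeasure Q] (hε0 : 0 < ε) (hε1 : ε ≤ 1)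
    (hminor : ∀ x, f x ≤ d → ENNReal.ofReal ε • Q ≤ P x)
    (hα : 1 ≤ α) (hΛ : 1 ≤ Λ)
    (hfar : ∀ s, d ≤ s → α * (1 + lam * s + 2 * b) ≤ 1 + s)
    (hnear : ∀ s, s ≤ d → 1 + lam * s + 2 * b ≤ Λ)
    {ν : Measure X} [IsProbabilityMeasure ν] (hν : ν.real Sᶜ = 0) (hνf : Integrable f ν)
    {c a : ℝ} {l k : ℕ} (hk : 1 ≤ k) (hc : 0 < c) (hcT : c < α ^ k) (hca : c * Λ ^ l ≤ a)
    (hla : (α * Λ) ^ l ≤ a) {B : Set X} (hB : MeasurableSet B) :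
    (ν.bind ⇑(P ^ k)).real B - π.real B ≤
      (1 - ε) ^ (l + 1) + (a * (1 + ∫ x, f x ∂ν + b / (1 - lam)) - c) / (α ^ k - c)
        + k * π.real Sᶜ + ∑ i ∈ Finset.Icc 1 k, (ν.bind ⇑(P ^ i)).real Sᶜ := by
  have := isMarkovKernel_pow P k
  set T := α ^ k with hT
  have hTc : 0 < T - c := by linarith
  set V := expectedVisits P Sᶜ k with hV
  set q := (1 - ε) ^ (l + 1) with hq
  have hq0 : 0 ≤ q := pow_nonneg (by linarith) _
  have hpt := kernel_pow_real_sub_le hS h0 hdrift hε0 hε1 hminor hα hΛ hfar hnear hc hcT hB k l a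
    hca (by rw [mul_comm]; exact mul_le_mul_of_nonneg_right hla (by positivity))
  have hVi : ∀ (ρ : Measure X) [IsFiniteMeasure ρ], Integrable V ρ :=
    fun ρ _ => integrable_expectedVisits P hS.compl k ρ
  set w : X → ℝ := fun x => V x + (q / 2 + (a - c) / (2 * (T - c))) + a / (T - c) * f x with hw
  have hwi : ∀ (ρ : Measure X) [IsFiniteMeasure ρ], Integrable f ρ → Integrable w ρ ∧
      ∫ x, w x ∂ρ = ∫ x, V x ∂ρ + (q / 2 + (a - c) / (2 * (T - c))) * ρ.real Set.univ
        + a / (T - c) * ∫ x, f x ∂ρ := fun ρ _ hf => by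
    have hv := hVi ρ
    refine ⟨by fun_prop, ?_⟩
    rw [hw, integral_add (by fun_prop) (by fun_prop), integral_add (by fun_prop) (by fun_prop),
      integral_const_mul]
    simp [mul_comm]
  obtain ⟨hwν, eν⟩ := hwi ν hνf
  obtain ⟨hwπ, eπ⟩ := hwi (π.restrict S) hfπ
  have main := integral_sub_integral_le (ν := ν) (π := π) hS
    (g := fun x => ((P ^ k) x).real B) (w := w) (fun x => measureReal_nonneg)
    (fun x => measureReal_le_one) (integrable_kernel_real _ _ hB) (integrable_kernel_real _ _ hB)
    hwν hwπ fun x y => (hpt x y).trans_eq (by simp only [hw]; field_simp; ring)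
  rw [← bind_kernel_real _ ν hB, ← bind_kernel_real _ π hB, (invariant_pow hπ k).def, eν, eπ] at main
  simp only [probReal_univ, measureReal_restrict_apply_univ] at main
  have v1 := integral_expectedVisits_le P hS.compl k ν hν
  have v2 := setIntegral_expectedVisits_le hπ hS hk
  have v0 := integral_expectedVisits_nonneg P Sᶜ k ν
  set p := π.real S
  have hp0 : 0 ≤ p := measureReal_nonneg
  have hp1 : p ≤ 1 := measureReal_le_one
  set F := ∫ x, f x ∂ν
  set Φ := ∫ x in S, f x ∂π
  have hF : 0 ≤ F := integral_nonneg h0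
  have hΛl : 1 ≤ Λ ^ l := one_le_pow₀ hΛ
  have ha : c ≤ a := by nlinarith
  have hΦ : Φ ≤ p * (b / (1 - lam)) := by
    rw [← mul_div_assoc, le_div_iff₀ (by linarith)]
    linarith
  have hbl : 0 ≤ b / (1 - lam) := div_nonneg hb (by linarith)
  have e1 : p * ((q / 2 + (a - c) / (2 * (T - c))) * 1 + a / (T - c) * F)
      + ((q / 2 + (a - c) / (2 * (T - c))) * p + a / (T - c) * Φ)
      ≤ q + (a * (1 + F + b / (1 - lam)) - c) / (T - c) := by
    have h1 : a * Φ ≤ a * (p * (b / (1 - lam))) := mul_le_mul_of_nonneg_left hΦ (by linarith)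
    have h2 : 0 ≤ a * (1 + F + b / (1 - lam)) - c := by
      have := mul_nonneg (hc.le.trans ha) (add_nonneg hF hbl)
      linarith
    calc _ = p * q + (p * (a * (1 + F)) + a * Φ - p * c) / (T - c) := by
          field_simp
          ring
      _ ≤ 1 * q + (1 * (a * (1 + F + b / (1 - lam)) - c)) / (T - c) := by
          refine add_le_add (mul_le_mul_of_nonneg_right hp1 hq0)
            (div_le_div_of_nonneg_right ?_ hTc.le)
          have := mul_le_mul_of_nonneg_right hp1 h2
          linarith
      _ = _ := by simp
  have e2 : p * ∫ x, V x ∂ν ≤ ∑ i ∈ Finset.Icc 1 k, (ν.bind ⇑(P ^ i)).real Sᶜ :=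
    (mul_le_of_le_one_left v0 hp1).trans v1
  linarith

/-! ### Choice of the parameters. -/

theorem mainTheorem1 {X : Type*} [MeasurableSpace X]
    (P : Kernel X X) [IsMarkovKernel P]
    (π : Measure X) [IsProbabilityMeasure π] (hπ : P.Invariant π)
    (R₀ : Set X) (hR₀ : MeasurableSet R₀)
    (f : X → ℝ) (lam b : ℝ) (hlam0 : 0 ≤ lam) (hlam1 : lam < 1)
    (hdrift : GeneralizedDrift P π R₀ hR₀ f lam b)
    (d : ℝ) (hd : 2 * b / (1 - lam) < d)
    (ε : ℝ) (hε : 0 < ε) (Q : Measure X) [IsProbabilityMeasure Q]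
    (hminor : ∀ x, f x ≤ d → ENNReal.ofReal ε • Q ≤ P x)
    (ν : Measure X) [IsProbabilityMeasure ν] (hν : ν R₀ = 1) (hνf : Integrable f ν)
    (α Λ : ℝ) (hα : α⁻¹ = (1 + 2 * b + lam * d) / (1 + d))
    (hΛ : Λ = 1 + 2 * (lam * d + b))
    (r : ℝ) (hr0 : 0 < r) (hr1 : r < 1) (k : ℕ) (hk : 1 ≤ k) :
    tvDist (ν.bind ⇑(P ^ k)) π ≤
      (1 - ε * Q.real R₀) ^ (r * k)
        + ((α * Λ) ^ (r * k) * (1 + ∫ x, f x ∂ν + b / (1 - lam)) - α ^ (r * k))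
            / (α ^ (k : ℝ) - α ^ (r * k))
        + k * π.real R₀ᶜ
        + ∑ i ∈ Finset.Icc 1 k, (ν.bind ⇑(P ^ i)).real R₀ᶜ := by
  have hν0 : ν.real R₀ᶜ = 0 := by
    rw [Measure.real, (prob_compl_eq_zero_iff hR₀).2 hν, ENNReal.toReal_zero]
  have hne : R₀.Nonempty := by
    by_contra h
    simp [Set.not_nonempty_iff_eq_empty.1 h] at hν
  obtain ⟨hf, h0, hdr, halt⟩ := hdrift
  obtain ⟨hb, hlow, hfπ, hπf⟩ := halt.elim
    (restricted_integral_le_of_sublevel hπ hR₀ hne hlam0 hlam1 hf h0 hdr)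
    (restricted_integral_le_of_reversible hne hlam0 hlam1 hf h0 hdr)
  have hd' : 2 * b < (1 - lam) * d := by
    rwa [div_lt_iff₀ (by linarith), mul_comm d] at hd
  have hd0 : 0 < d := by
    by_contra! h
    nlinarith
  -- The minorization bounds `ε` only if some point has `f ≤ d`; the drift provides one.
  have hε1 : ε ≤ 1 := by
    obtain ⟨x, -, hx⟩ := hlow d (by linarith)
    have h := hminor x hx.le Set.univ
    simpa using h
  have hld : 0 ≤ lam * d := mul_nonneg hlam0 hd0.le
  have hαe : α = (1 + d) / (1 + 2 * b + lam * d) := by rw [← inv_inv α, hα, inv_div]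
  have hα1 : 1 < α := by
    rw [hαe, one_lt_div (by linarith)]
    linarith
  have hΛ1 : 1 ≤ Λ := by linarith
  have hα0 : 0 < α := by linarith
  have hΛ0 : 0 < Λ := by linarith
  have hfar : ∀ s, d ≤ s → α * (1 + lam * s + 2 * b) ≤ 1 + s := fun s hs => by
    rw [hαe, div_mul_eq_mul_div, div_le_iff₀ (by linarith)]
    -- After cross-multiplication the difference of the two sides is `(s - d) * (1 + 2 * b - lam)`.
    nlinarith [mul_nonneg (sub_nonneg.2 hs) (show 0 ≤ 1 + 2 * b - lam by linarith)]
  have hnear : ∀ s, s ≤ d → 1 + lam * s + 2 * b ≤ Λ := fun s hs => by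
    have := mul_le_mul_of_nonneg_left hs hlam0
    linarith
  have hk0 : (0 : ℝ) < k := by exact_mod_cast hk
  have hrk : 0 < r * k := mul_pos hr0 hk0
  -- Here `l + 1 = ⌈r * k⌉`, so `l ≤ r * k` controls the weights and `r * k ≤ l + 1` the power of `1
  -- - ε`.
  obtain ⟨l, hl⟩ := Nat.exists_eq_add_of_le' (Nat.one_le_ceil_iff.2 hrk)
  have hl1 : (l : ℝ) ≤ r * k := by
    have := Nat.ceil_lt_add_one hrk.le
    rw [hl] at this
    push_cast at this
    linarith
  have hl2 : r * k ≤ ((l + 1 : ℕ) : ℝ) := hl ▸ Nat.le_ceil (r * k)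
  have hcT : α ^ (r * k) < α ^ k := by
    rw [← Real.rpow_natCast]
    exact Real.rpow_lt_rpow_of_exponent_lt hα1 (by nlinarith)
  have hΛl : Λ ^ l ≤ Λ ^ (r * k) := by
    rw [← Real.rpow_natCast]
    exact Real.rpow_le_rpow_of_exponent_le hΛ1 hl1
  have hca : α ^ (r * k) * Λ ^ l ≤ (α * Λ) ^ (r * k) := by
    rw [Real.mul_rpow hα0.le hΛ0.le]
    exact mul_le_mul_of_nonneg_left hΛl (Real.rpow_nonneg hα0.le _)
  have hla : (α * Λ) ^ l ≤ (α * Λ) ^ (r * k) := by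
    rw [← Real.rpow_natCast]
    exact Real.rpow_le_rpow_of_exponent_le (by nlinarith) hl1
  have hqle : (1 - ε) ^ (l + 1) ≤ (1 - ε * Q.real R₀) ^ (r * k) := by
    have hQ0 : 0 ≤ Q.real R₀ := measureReal_nonneg
    have hQ1 : Q.real R₀ ≤ 1 := measureReal_le_one
    have h1 : ε * Q.real R₀ ≤ ε := mul_le_of_le_one_right hε.le hQ1
    have h2 : 0 ≤ ε * Q.real R₀ := mul_nonneg hε.le hQ0
    refine (pow_le_pow_left₀ (sub_nonneg.2 hε1) (sub_le_sub_left h1 1) (l + 1)).trans ?_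
    rw [← Real.rpow_natCast]
    exact Real.rpow_le_rpow_of_exponent_ge' (by linarith) (by linarith) hrk.le hl2
  have hmk := isMarkovKernel_pow P k
  have key : ∀ B, MeasurableSet B → (ν.bind ⇑(P ^ k)).real B - π.real B ≤
      (1 - ε * Q.real R₀) ^ (r * k)
        + ((α * Λ) ^ (r * k) * (1 + ∫ x, f x ∂ν + b / (1 - lam)) - α ^ (r * k))
            / (α ^ (k : ℝ) - α ^ (r * k))
        + k * π.real R₀ᶜ
        + ∑ i ∈ Finset.Icc 1 k, (ν.bind ⇑(P ^ i)).real R₀ᶜ := fun B hB => by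
    -- Applied with `c = α ^ (r * k)` and `a = (α * Λ) ^ (r * k)`.
    have := bind_pow_real_sub_le hπ hR₀ h0 hlam1 hdr hfπ hπf hb hε hε1 hminor hα1.le hΛ1 hfar hnear
      hν0 hνf hk (Real.rpow_pos_of_pos hα0 _) hcT hca hla hB
    rw [Real.rpow_natCast]
    linarith
  have : Nonempty {B : Set X // MeasurableSet B} := ⟨⟨∅, MeasurableSet.empty⟩⟩
  have hprob : IsProbabilityMeasure (ν.bind ⇑(P ^ k)) := inferInstance
  refine ciSup_le fun ⟨B, hB⟩ => abs_sub_le_iff.2 ⟨key B hB, ?_⟩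
  -- The reverse inequality is the one-sided bound for the complement.
  have := key Bᶜ hB.compl
  rw [probReal_compl_eq_one_sub hB, probReal_compl_eq_one_sub hB] at this
  linarith
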